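/- All Lie algebras are over $\mathbb{C}$. A biderivation of a Lie algebra $L$ is a bilinear map $\delta : L\times L\to L$ with $\delta([x,y],z)=[x,\delta(y,z)]-[y,\delta(x,z)]$ and $\delta(x,[y,z])=[y,\delta(x,z)]-[z,\delta(x,y)]$ for all $x,y,z\in L$; it is symmetric if $\delta(x,y)=\delta(y,x)$ for all $x,y$. Let $n\ge 1$ and let $H_n=\mathbb{C}^{2n}\oplus\mathbb{C}z$ be the Heisenberg Lie algebra, in which $z$ is central, $[e_i,e_{n+i}]=z$ for $1\le i\le n$, and all other brackets of basis vectors $e_j,e_k$ with $j<k$ are zero. Let $\mathfrak{sp}_{2n}(\mathbb{C})$ be the Lie algebra of the matrices $\begin{pmatrix}A&B\\ C&-A^{\mathrm T}\end{pmatrix}$ with $B=B^{\mathrm T}$ and $C=C^{\mathrm T}$. It acts on $H_n$ by derivations through $x\cdot v=xv$ for $v\in\mathbb{C}^{2n}$ and $x\cdot z=0$. (a) Let $\mathcal{S}_n=(\mathfrak{sl}_2(\mathbb{C})\oplus\mathfrak{sp}_{2n}(\mathbb{C}))\ltimes H_n$, where $\mathfrak{sp}_{2n}(\mathbb{C})$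 acts on $H_n$ as above and $\mathfrak{sl}_2(\mathbb{C})$ acts by zero (the only action of $\mathfrak{sl}_2(\mathbb{C})$ by derivations of $H_n$ that commutes with that of $\mathfrak{sp}_{2n}(\mathbb{C})$). Then the only symmetric biderivation of $\mathcal{S}_n$ is $\delta=0$. (b) Let $n\neq 2$ and let $\mathcal{S}_n'=(\mathfrak{sl}_2(\mathbb{C})\oplus\mathfrak{so}_n(\mathbb{C}))\ltimes H_n$ be the Schrödinger algebra in $(n+1)$-dimensional space-time, where $\mathfrak{so}_n(\mathbb{C})$ is the Lie algebra of skew-symmetric $n\times n$ matrices and, writing elements of $\mathbb{C}^{2n}$ as $(p,q)$ with $p,q\in\mathbb{C}^n$, the action on $H_n$ is $\begin{pmatrix}a&b\\ c&-a\end{pmatrix}\cdot(p,q)=(ap+bq,\,cp-aq)$, $A\cdot(p,q)=(Ap,Aq)$ for $A\in\mathfrak{so}_n(\mathbb{C})$, and $z$ is annihilated. Then the only symmetric biderivation of $\mathcal{S}_n'$ is $\delta=0$. -/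

import Mathlib

/-- The Heisenberg Lie algebra `H_n = ℂ^{2n} ⊕ ℂ z`: the element `⟨v, t⟩` stands for `v + t z`.
The standard basis of `ℂ^{2n}` is indexed by `Fin n ⊕ Fin n`, with `inl i` for `e_i` and `inr i`
for `e_{n+i}`. -/
@[ext]
structure HeisenbergAlgebra (n : ℕ) where
  /-- The component in `ℂ^{2n}`. -/
  vec : Fin n ⊕ Fin n → ℂ
  /-- The coefficient of the central element `z`. -/
  coeff : ℂ

namespace HeisenbergAlgebra

variable {n : ℕ}

/-- As a vector space, `H_n` is `ℂ^{2n} × ℂ`. -/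
def toProd : HeisenbergAlgebra n ≃ (Fin n ⊕ Fin n → ℂ) × ℂ where
  toFun x := (x.vec, x.coeff)
  invFun p := ⟨p.1, p.2⟩
  left_inv _ := rfl
  right_inv _ := rfl

instance : AddCommGroup (HeisenbergAlgebra n) := toProd.addCommGroup

noncomputable instance : Module ℂ (HeisenbergAlgebra n) := toProd.module ℂ

@[simp] theorem vec_zero : (0 : HeisenbergAlgebra n).vec = 0 := rfl
@[simp] theorem coeff_zero : (0 : HeisenbergAlgebra n).coeff = 0 := rfl
@[simp] theorem vec_add (x y : HeisenbergAlgebra n) : (x + y).vec = x.vec + y.vec := rfl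
@[simp] theorem coeff_add (x y : HeisenbergAlgebra n) : (x + y).coeff = x.coeff + y.coeff := rfl
@[simp] theorem vec_sub (x y : HeisenbergAlgebra n) : (x - y).vec = x.vec - y.vec := rfl
@[simp] theorem coeff_sub (x y : HeisenbergAlgebra n) : (x - y).coeff = x.coeff - y.coeff := rfl
@[simp] theorem vec_smul (c : ℂ) (x : HeisenbergAlgebra n) : (c • x).vec = c • x.vec := rfl
@[simp] theorem coeff_smul (c : ℂ) (x : HeisenbergAlgebra n) : (c • x).coeff = c * x.coeff := rfl

/-- The alternating form on `ℂ^{2n}` with `ω(e_i, e_{n+i}) = 1 = -ω(e_{n+i}, e_i)` and all other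
values on basis vectors zero. -/
noncomputable def omega (v w : Fin n ⊕ Fin n → ℂ) : ℂ :=
  ∑ i : Fin n, (v (Sum.inl i) * w (Sum.inr i) - v (Sum.inr i) * w (Sum.inl i))

/-- The bracket `[v + s z, w + t z] = ω(v, w) z`; so `[e_i, e_{n+i}] = z` and `z` is central. -/
noncomputable instance : Bracket (HeisenbergAlgebra n) (HeisenbergAlgebra n) where
  bracket x y := ⟨0, omega x.vec y.vec⟩

@[simp] theorem vec_lie (x y : HeisenbergAlgebra n) : ⁅x, y⁆.vec = 0 := rfl
@[simp] theorem coeff_lie (x y : HeisenbergAlgebra n) :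
    ⁅x, y⁆.coeff = omega x.vec y.vec := rfl

theorem omega_add_left (u v w : Fin n ⊕ Fin n → ℂ) :
    omega (u + v) w = omega u w + omega v w := by
  simp only [omega, ← Finset.sum_add_distrib, Pi.add_apply]
  exact Finset.sum_congr rfl fun i _ => by ring

theorem omega_add_right (u v w : Fin n ⊕ Fin n → ℂ) :
    omega u (v + w) = omega u v + omega u w := by
  simp only [omega, ← Finset.sum_add_distrib, Pi.add_apply]
  exact Finset.sum_congr rfl fun i _ => by ring

theorem omega_smul_right (c : ℂ) (v w : Fin n ⊕ Fin n → ℂ) :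
    omega v (c • w) = c * omega v w := by
  simp only [omega, Finset.mul_sum, Pi.smul_apply, smul_eq_mul]
  exact Finset.sum_congr rfl fun i _ => by ring

theorem omega_self (v : Fin n ⊕ Fin n → ℂ) : omega v v = 0 :=
  Finset.sum_eq_zero fun i _ => by ring

@[simp] theorem omega_zero_left (v : Fin n ⊕ Fin n → ℂ) : omega 0 v = 0 := by simp [omega]

@[simp] theorem omega_zero_right (v : Fin n ⊕ Fin n → ℂ) : omega v 0 = 0 := by simp [omega]

noncomputable instance : LieRing (HeisenbergAlgebra n) where
  add_lie x y z := by ext <;> simp [omega_add_left]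
  lie_add x y z := by ext <;> simp [omega_add_right]
  lie_self x := by ext <;> simp [omega_self]
  leibniz_lie x y z := by ext <;> simp

noncomputable instance : LieAlgebra ℂ (HeisenbergAlgebra n) where
  lie_smul c x y := by ext <;> simp [omega_smul_right]

theorem omega_eq_dotProduct (v w : Fin n ⊕ Fin n → ℂ) :
    omega v w = - (v ⬝ᵥ (Matrix.J (Fin n) ℂ).mulVec w) := by
  simp [omega, Matrix.J, Matrix.fromBlocks_mulVec, dotProduct, Fintype.sum_sum_type,
    Matrix.neg_mulVec, Finset.sum_add_distrib, sub_eq_add_neg, add_comm]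

/-- Matrices in `sp_{2n}` are skew for `ω`. -/
theorem omega_mulVec_add (M : LieAlgebra.Symplectic.sp (Fin n) ℂ) (v w : Fin n ⊕ Fin n → ℂ) :
    omega (M.val.mulVec v) w + omega v (M.val.mulVec w) = 0 := by
  have h : M.val.transpose * Matrix.J (Fin n) ℂ = Matrix.J (Fin n) ℂ * -M.val :=
    (mem_skewAdjointMatricesSubmodule _ _).1
      ((mem_skewAdjointMatricesLieSubalgebra _ _).1 M.property)
  rw [omega_eq_dotProduct, omega_eq_dotProduct, Matrix.mulVec_mulVec, ← Matrix.vecMul_transpose,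
    ← Matrix.dotProduct_mulVec, Matrix.mulVec_mulVec, h]
  simp [Matrix.neg_mulVec]

/-- The natural action of `sp_{2n}(ℂ)` on `H_n` by derivations: `[M, v] = M v` on `ℂ^{2n}` and
`[M, z] = 0`. -/
noncomputable def spAction (n : ℕ) :
    LieAlgebra.Symplectic.sp (Fin n) ℂ →ₗ⁅ℂ⁆
      LieDerivation ℂ (HeisenbergAlgebra n) (HeisenbergAlgebra n) where
  toFun M :=
    { toFun := fun x => ⟨M.val.mulVec x.vec, 0⟩
      map_add' := fun x y => by ext <;> simp [Matrix.mulVec_add]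
      map_smul' := fun c x => by ext <;> simp [Matrix.mulVec_smul]
      leibniz' := fun x y => by
        have h := omega_mulVec_add M x.vec y.vec
        ext
        · simp
        · have hs : omega y.vec (M.val.mulVec x.vec) = - omega (M.val.mulVec x.vec) y.vec := by
            have hz := omega_self (y.vec + M.val.mulVec x.vec)
            rw [omega_add_left, omega_add_right, omega_add_right, omega_self, omega_self] at hz
            linear_combination hz
          simp [hs]
          linear_combination -h }
  map_add' M N := by ext x <;> simp [Matrix.add_mulVec]
  map_smul' c M := by ext x <;> simp [Matrix.smul_mulVec]
  map_lie' {M N} := by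
    ext x <;> simp [Ring.lie_def, Matrix.sub_mulVec]

end HeisenbergAlgebra

/-- The homomorphism `sl_2(ℂ) ⊕ so_n(ℂ) → sp_{2n}(ℂ)` that describes the action on
`ℂ^{2n} = ℂ^2 ⊗ ℂ^n`. Writing an element of `ℂ^{2n}` as `(p, q)` with `p, q ∈ ℂ^n`, the matrix
`(a, b; c, d)` in `sl_2` sends it to `(a p + b q, c p + d q)`, and `A` in `so_n` sends it to
`(A p, A q)`. -/
noncomputable def slSoToSp (n : ℕ) :
    (LieAlgebra.SpecialLinear.sl (Fin 2) ℂ × LieAlgebra.Orthogonal.so (Fin n) ℂ) →ₗ⁅ℂ⁆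
      LieAlgebra.Symplectic.sp (Fin n) ℂ where
  toFun x :=
    ⟨Matrix.fromBlocks
      (x.1.val 0 0 • (1 : Matrix (Fin n) (Fin n) ℂ) + x.2.val)
      (x.1.val 0 1 • (1 : Matrix (Fin n) (Fin n) ℂ))
      (x.1.val 1 0 • (1 : Matrix (Fin n) (Fin n) ℂ))
      (x.1.val 1 1 • (1 : Matrix (Fin n) (Fin n) ℂ) + x.2.val), by
      have hA := (LieAlgebra.Orthogonal.mem_so (Fin n) ℂ x.2.val).1 x.2.property
      have hX : x.1.val 1 1 = - x.1.val 0 0 := by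
        have h := (LinearMap.mem_ker (f := Matrix.traceLinearMap (Fin 2) ℂ ℂ)).1 x.1.property
        rw [Matrix.traceLinearMap_apply, Matrix.trace_fin_two] at h
        linear_combination h
      rw [LieAlgebra.Symplectic.sp, mem_skewAdjointMatricesLieSubalgebra,
        mem_skewAdjointMatricesSubmodule]
      change _ * _ = _ * _
      simp [Matrix.J, Matrix.fromBlocks_transpose, Matrix.fromBlocks_multiply,
        Matrix.fromBlocks_neg, hA, hX]
      constructor <;> abel⟩
  map_add' x y := by
    ext1
    simp only [Prod.fst_add, Prod.snd_add, AddMemClass.coe_add, Matrix.add_apply, add_smul,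
      Matrix.fromBlocks_add]
    congr 1
    · abel
    · abel
  map_smul' c x := by
    ext1
    simp [Matrix.fromBlocks_smul, mul_smul]
  map_lie' {x y} := by
    ext1
    simp only [LieAlgebra.Prod.bracket_apply, LieSubalgebra.coe_bracket, Ring.lie_def,
      Matrix.fromBlocks_multiply, Matrix.sub_apply, Matrix.mul_apply, Fin.sum_univ_two,
      sub_eq_add_neg, Matrix.fromBlocks_neg, Matrix.fromBlocks_add]
    congr 1 <;>
    · simp only [mul_add, add_mul, Matrix.smul_mul, Matrix.mul_smul, one_mul, mul_one]
      module

/-- The Lie algebra `(sl_2(ℂ) ⊕ sp_{2n}(ℂ)) ⋉ H_n`, where `sp_{2n}` acts on `H_n` naturally and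
`sl_2` acts by zero. For `n ≥ 1` this is the only semidirect product of this shape in which
`sp_{2n}` acts naturally: the operators by which `sl_2` acts commute with the diagonal matrices of
`sp_{2n}`, whose weights on `H_n` are pairwise distinct, so they are simultaneously diagonal, and
`sl_2` is perfect. -/
abbrev SchrodingerSp (n : ℕ) : Type :=
  LieAlgebra.SemiDirectSum (HeisenbergAlgebra n)
    (LieAlgebra.SpecialLinear.sl (Fin 2) ℂ × LieAlgebra.Symplectic.sp (Fin n) ℂ)
    ((HeisenbergAlgebra.spAction n).comp
      (LieHom.snd ℂ (LieAlgebra.SpecialLinear.sl (Fin 2) ℂ)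
        (LieAlgebra.Symplectic.sp (Fin n) ℂ)))

/-- The Schrödinger algebra `(sl_2(ℂ) ⊕ so_n(ℂ)) ⋉ H_n` of `(n+1)`-dimensional space-time, where
`sl_2 ⊕ so_n` acts on `ℂ^{2n} = ℂ^2 ⊗ ℂ^n` naturally and kills `z`. -/
abbrev SchrodingerSO (n : ℕ) : Type :=
  LieAlgebra.SemiDirectSum (HeisenbergAlgebra n)
    (LieAlgebra.SpecialLinear.sl (Fin 2) ℂ × LieAlgebra.Orthogonal.so (Fin n) ℂ)
    ((HeisenbergAlgebra.spAction n).comp (slSoToSp n))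

/-- A bilinear map `δ : L × L → V` into an `L`-module is a biderivation if it is a derivation in
each of its two arguments. -/
structure IsBiderivation {L V : Type*} [LieRing L] [LieAlgebra ℂ L] [AddCommGroup V] [Module ℂ V]
    [LieRingModule L V] [LieModule ℂ L V] (δ : L →ₗ[ℂ] L →ₗ[ℂ] V) : Prop where
  lie_left : ∀ x y z : L, δ ⁅x, y⁆ z = ⁅x, δ y z⁆ - ⁅y, δ x z⁆
  lie_right : ∀ x y z : L, δ x ⁅y, z⁆ = ⁅y, δ x z⁆ - ⁅z, δ x y⁆

/-- A symmetric biderivation: a biderivation `δ` with `δ(x, y) = δ(y, x)`. -/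
structure IsSymmBiderivation {L V : Type*} [LieRing L] [LieAlgebra ℂ L] [AddCommGroup V]
    [Module ℂ V] [LieRingModule L V] [LieModule ℂ L V] (δ : L →ₗ[ℂ] L →ₗ[ℂ] V) : Prop
    extends IsBiderivation δ where
  symm : ∀ x y : L, δ x y = δ y x

/-!
Let `h, e, f` be an `sl₂`-triple in `L` and `δ` a symmetric biderivation with values in a
finite-dimensional module. The cyclic sum of `δ([x, y], z)` vanishes, and applied to the triple it
shows that the Casimir element of `sl₂` kills `δ(h, h)`. On a finite-dimensional `sl₂`-module the
Casimir element kills only invariants, so comparing weights gives first `δ(h, e) = δ(h, h) = 0` and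
then `δ(e, ·) = 0`; hence `δ` vanishes on every copy of `sl₂`.

If `δ(s, ·) = δ(t, ·) = 0`, evaluating `δ([s, x], [t, y])` in two ways gives
`[[s, t], δ(x, y)] = 0`. For `s` in a copy of `sl₂`, which is perfect, therefore
`δ([s, x], y) = [s, δ(x, y)] = 0`. Thus `δ` vanishes on the subalgebra generated by all such
`[s, x]`, which is the ideal generated by the copies of `sl₂`. Both Schrödinger algebras coincide
with that ideal: `sl₂`, `sp` and, for `n ≠ 2`, `so_n` are generated as ideals by their
`sl₂`-triples, and `H_n` is generated by the image of the action on it.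
-/

section SlTwoModules

variable {R L M : Type*} [CommRing R] [LieRing L] [LieAlgebra R L] [AddCommGroup M] [Module R M]
  [LieRingModule L M] [LieModule R L M] {h e f : L}

theorem lie_h_lie_e (t : IsSl2Triple h e f) (m : M) :
    ⁅h, ⁅e, m⁆⁆ = (2 : R) • ⁅e, m⁆ + ⁅e, ⁅h, m⁆⁆ := by
  rw [leibniz_lie, t.lie_h_e_smul R, smul_lie]

theorem lie_h_lie_f (t : IsSl2Triple h e f) (m : M) :
    ⁅h, ⁅f, m⁆⁆ = -((2 : R) • ⁅f, m⁆) + ⁅f, ⁅h, m⁆⁆ := by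
  rw [leibniz_lie, t.lie_lie_smul_f R, neg_lie, smul_lie]

theorem lie_e_lie_f (t : IsSl2Triple h e f) (m : M) : ⁅e, ⁅f, m⁆⁆ = ⁅h, m⁆ + ⁅f, ⁅e, m⁆⁆ := by
  rw [leibniz_lie, t.lie_e_f]

variable (R M) in
/-- The action on `M` of the Casimir element of `sl₂`, normalized as `h² + 2h + 4fe` so that its
value on a highest weight vector can be read off from the weight. -/
def sl2Casimir (h e f : L) : Module.End R M :=
  LieModule.toEnd R L M h * LieModule.toEnd R L M h + (2 : R) • LieModule.toEnd R L M h +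
    (4 : R) • (LieModule.toEnd R L M f * LieModule.toEnd R L M e)

theorem sl2Casimir_apply (h e f : L) (m : M) :
    sl2Casimir R M h e f m = ⁅h, ⁅h, m⁆⁆ + (2 : R) • ⁅h, m⁆ + (4 : R) • ⁅f, ⁅e, m⁆⁆ :=
  rfl

theorem sl2Casimir_lie (t : IsSl2Triple h e f) {x : L} (hx : x ∈ t.toLieSubalgebra R) (m : M) :
    sl2Casimir R M h e f ⁅x, m⁆ = ⁅x, sl2Casimir R M h e f m⁆ := by
  have lie_e (m : M) : sl2Casimir R M h e f ⁅e, m⁆ = ⁅e, sl2Casimir R M h e f m⁆ := by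
    simp only [sl2Casimir_apply, lie_add, lie_smul, lie_h_lie_e (R := R) t, lie_e_lie_f t]
    module
  have lie_f (m : M) : sl2Casimir R M h e f ⁅f, m⁆ = ⁅f, sl2Casimir R M h e f m⁆ := by
    simp only [sl2Casimir_apply, lie_add, lie_smul, lie_neg, lie_h_lie_f (R := R) t,
      lie_e_lie_f t]
    module
  obtain ⟨a, b, c, rfl⟩ := t.mem_toLieSubalgebra_iff.1 hx
  simp only [add_lie, smul_lie, lie_lie, map_add, map_sub, map_smul, lie_e, lie_f]

end SlTwoModules

section Perfect

variable {R L M : Type*} [CommRing R] [LieRing L] [LieAlgebra R L] [AddCommGroup M] [Module R M]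
  [LieRingModule L M] [LieModule R L M]

variable (R) in
/-- A subset `S` of a Lie algebra is perfect if every element of `S` is a linear combination of
brackets of elements of `S`; a subalgebra is perfect in this sense iff it is a perfect Lie algebra.
Unlike subalgebras, perfect subsets are closed under unions. -/
def IsPerfectSubset (S : Set L) : Prop :=
  S ⊆ Submodule.span R (Set.image2 (⁅·, ·⁆) S S)

namespace IsPerfectSubset

variable {S : Set L}

theorem iUnion {ι : Sort*} {S : ι → Set L} (hS : ∀ i, IsPerfectSubset R (S i)) :
    IsPerfectSubset R (⋃ i, S i) :=
  Set.iUnion_subset fun i => (hS i).trans <| Submodule.span_mono <|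
    Set.image2_subset (Set.subset_iUnion S i) (Set.subset_iUnion S i)

theorem lie_mem (hS : IsPerfectSubset R S) {N : Submodule R M} {m : M}
    (h : ∀ x ∈ S, ∀ y ∈ S, ⁅⁅x, y⁆, m⁆ ∈ N) {x : L} (hx : x ∈ S) : ⁅x, m⁆ ∈ N := by
  have le : Submodule.span R (Set.image2 (⁅·, ·⁆) S S) ≤
      N.comap ((LieModule.toEnd R L M : L →ₗ[R] Module.End R M).flip m) :=
    Submodule.span_le.2 (Set.image2_subset_iff.2 h)
  exact le (hS hx)

end IsPerfectSubset

theorem toLieSubalgebra_le_iff {h e f : L} (t : IsSl2Triple h e f) {P : Submodule R L} :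
    (t.toLieSubalgebra R).toSubmodule ≤ P ↔ e ∈ P ∧ f ∈ P ∧ h ∈ P := by
  change Submodule.span R {e, f, h} ≤ P ↔ _
  simp only [Submodule.span_le, Set.insert_subset_iff, Set.singleton_subset_iff, SetLike.mem_coe]

theorem isPerfectSubset_toLieSubalgebra {K : Type*} [Field K] [NeZero (2 : K)] [LieAlgebra K L]
    {h e f : L} (t : IsSl2Triple h e f) :
    IsPerfectSubset K (t.toLieSubalgebra K : Set L) := by
  obtain ⟨e_mem, f_mem, h_mem⟩ := (toLieSubalgebra_le_iff (R := K) t).1 le_rfl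
  refine (toLieSubalgebra_le_iff t).2 ⟨?_, ?_, ?_⟩
  · exact (Submodule.smul_mem_iff _ (two_ne_zero (α := K))).1
      (Submodule.subset_span ⟨h, h_mem, e, e_mem, t.lie_h_e_smul K⟩)
  · exact (Submodule.smul_mem_iff _ (two_ne_zero (α := K))).1 (neg_mem_iff.1
      (Submodule.subset_span ⟨h, h_mem, f, f_mem, t.lie_lie_smul_f K⟩))
  · exact Submodule.subset_span ⟨e, e_mem, f, f_mem, t.lie_e_f⟩

end Perfect

section CasimirKernel

open LieModule

variable {K L M : Type*} [Field K] [CharZero K] [LieRing L] [LieAlgebra K L]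
  [AddCommGroup M] [Module K M] [LieRingModule L M] [LieModule K L M] [FiniteDimensional K M]
  {h e f : L}

theorem lie_eq_zero_of_hasPrimitiveVectorWith {t : IsSl2Triple h e f}
    {m : M} {μ : K} (P : t.HasPrimitiveVectorWith m μ) (hm : sl2Casimir K M h e f m = 0)
    {x : L} (hx : x ∈ t.toLieSubalgebra K) : ⁅x, m⁆ = 0 := by
  obtain ⟨n, rfl⟩ := P.exists_nat
  have hn : ((n * n + 2 * n : ℕ) : K) • m = 0 := by
    rw [sl2Casimir_apply, P.lie_e, P.lie_h, lie_smul, P.lie_h, lie_zero] at hm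
    push_cast
    linear_combination (norm := module) hm
  obtain rfl : n = 0 := by
    have := Nat.cast_eq_zero.1 ((smul_eq_zero.1 hn).resolve_right P.ne_zero)
    lia
  have hf : ⁅f, m⁆ = 0 := by
    simpa using P.pow_toEnd_f_eq_zero_of_eq_nat (n := 0) rfl
  obtain ⟨a, b, c, rfl⟩ := t.mem_toLieSubalgebra_iff.1 hx
  simp [t.lie_e_f, P.lie_e, P.lie_h, hf]

variable [IsAlgClosed K]

theorem isTrivial_of_sl2Casimir_eq_zero (t : IsSl2Triple h e f) (ht : t.toLieSubalgebra K = ⊤)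
    (hC : sl2Casimir K M h e f = 0) : LieModule.IsTrivial L M := by
  have mem_t (x : L) : x ∈ t.toLieSubalgebra K := ht ▸ LieSubalgebra.mem_top x
  set N := maxTrivSubmodule K L M
  have mem_of_lie_mem {m : M} (hm : ∀ x : L, ⁅x, m⁆ ∈ N) : m ∈ N := by
    rw [mem_maxTrivSubmodule]
    intro x
    refine (isPerfectSubset_toLieSubalgebra t).lie_mem (N := ⊥) (fun y _ z _ => ?_) (mem_t x)
    rw [Submodule.mem_bot, lie_lie, hm z y, hm y z, sub_zero]
  suffices N = ⊤ from (isTrivial_iff_max_triv_eq_top K L M).2 this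
  by_contra hN
  have : Nontrivial (M ⧸ N) := Submodule.Quotient.nontrivial_iff.2 (by simpa using hN)
  obtain ⟨μ, q, hq, P⟩ := t.exists_hasPrimitiveVectorWith (R := K) (M := M ⧸ N)
  obtain ⟨m, rfl⟩ := LieSubmodule.Quotient.surjective_mk' N q
  have hCm : sl2Casimir K (M ⧸ N) h e f (LieSubmodule.Quotient.mk' N m) = 0 := by
    simp only [sl2Casimir_apply, ← LieModuleHom.map_lie, ← map_smul, ← map_add]
    rw [← sl2Casimir_apply, hC, LinearMap.zero_apply, map_zero]
  refine hq (LieSubmodule.Quotient.mk_eq_zero'.2 (mem_of_lie_mem fun x => ?_))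
  rw [← LieSubmodule.Quotient.mk_eq_zero']
  exact lie_eq_zero_of_hasPrimitiveVectorWith P hCm (mem_t x)

theorem lie_eq_zero_of_sl2Casimir_eq_zero (t : IsSl2Triple h e f) {m : M}
    (hm : sl2Casimir K M h e f m = 0) {x : L} (hx : x ∈ t.toLieSubalgebra K) : ⁅x, m⁆ = 0 := by
  obtain ⟨e_mem, f_mem, h_mem⟩ := (toLieSubalgebra_le_iff (R := K) t).1 le_rfl
  let T := t.toLieSubalgebra K
  have t' : IsSl2Triple (⟨h, h_mem⟩ : T) ⟨e, e_mem⟩ ⟨f, f_mem⟩ :=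
    ⟨by simpa [Subtype.ext_iff] using t.h_ne_zero, Subtype.ext t.lie_e_f,
      Subtype.ext t.lie_h_e_nsmul, Subtype.ext t.lie_h_f_nsmul⟩
  have ht' : t'.toLieSubalgebra K = ⊤ := by
    refine eq_top_iff.2 fun ⟨y, hy⟩ _ => ?_
    obtain ⟨a, b, c, rfl⟩ := t.mem_toLieSubalgebra_iff.1 hy
    exact t'.mem_toLieSubalgebra_iff.2 ⟨a, b, c, rfl⟩
  let N : LieSubmodule K T M :=
    { LinearMap.ker (sl2Casimir K M h e f) with
      lie_mem := fun {y m} hm => by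
        change sl2Casimir K M h e f m = 0 at hm
        change sl2Casimir K M h e f ⁅(y : L), m⁆ = 0
        rw [sl2Casimir_lie t y.2, hm, lie_zero] }
  have hN : sl2Casimir K N (⟨h, h_mem⟩ : T) ⟨e, e_mem⟩ ⟨f, f_mem⟩ = 0 :=
    LinearMap.ext fun y => Subtype.ext y.2
  have := isTrivial_of_sl2Casimir_eq_zero t' ht' hN
  exact congrArg Subtype.val (trivial_lie_zero T N ⟨x, hx⟩ ⟨m, hm⟩)

theorem eq_zero_of_lie_h_eq_two_smul (t : IsSl2Triple h e f) {m : M} (hh : ⁅h, m⁆ = (2 : K) • m)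
    (hef : ⁅e, ⁅f, m⁆⁆ = 0) : m = 0 := by
  have hfe := lie_e_lie_f t m
  rw [hef, hh] at hfe
  have hC : sl2Casimir K M h e f m = 0 := by
    rw [sl2Casimir_apply, hh, lie_smul, hh]
    linear_combination (norm := module) (-4 : K) • hfe
  have h_mem : h ∈ t.toLieSubalgebra K := ((toLieSubalgebra_le_iff t).1 le_rfl).2.2
  have hm := lie_eq_zero_of_sl2Casimir_eq_zero t hC h_mem
  rw [hh] at hm
  exact (smul_eq_zero.1 hm).resolve_left two_ne_zero

end CasimirKernel

namespace IsSymmBiderivation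

variable {L V : Type*} [LieRing L] [LieAlgebra ℂ L] [AddCommGroup V] [Module ℂ V]
  [LieRingModule L V] [LieModule ℂ L V] {δ : L →ₗ[ℂ] L →ₗ[ℂ] V}

theorem cyclic (hδ : IsSymmBiderivation δ) (x y z : L) :
    δ ⁅x, y⁆ z + δ ⁅y, z⁆ x + δ ⁅z, x⁆ y = 0 := by
  rw [hδ.lie_left, hδ.lie_left, hδ.lie_left, hδ.symm z x, hδ.symm y x, hδ.symm z y]
  abel

theorem apply_lie_left (hδ : IsSymmBiderivation δ) {s : L} (hs : δ s = 0) (x y : L) :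
    δ ⁅s, x⁆ y = ⁅s, δ x y⁆ := by
  rw [hδ.lie_left, hs, LinearMap.zero_apply, lie_zero, sub_zero]

theorem apply_lie_right (hδ : IsSymmBiderivation δ) {s : L} (hs : δ s = 0) (x y : L) :
    δ x ⁅s, y⁆ = ⁅s, δ x y⁆ := by
  rw [hδ.symm, hδ.apply_lie_left hs, hδ.symm]

theorem lie_lie_apply (hδ : IsSymmBiderivation δ) {s t : L} (hs : δ s = 0) (ht : δ t = 0)
    (x y : L) : ⁅⁅s, t⁆, δ x y⁆ = 0 := by
  have expand_left : δ ⁅s, x⁆ ⁅t, y⁆ = ⁅s, ⁅t, δ x y⁆⁆ := by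
    rw [hδ.apply_lie_left hs, hδ.apply_lie_right ht]
  have expand_right : δ ⁅s, x⁆ ⁅t, y⁆ = ⁅t, ⁅s, δ x y⁆⁆ := by
    rw [hδ.apply_lie_right ht, hδ.apply_lie_left hs]
  rw [lie_lie, ← expand_left, expand_right, sub_self]

/-- The elements at which a symmetric biderivation vanishes form a Lie subalgebra. -/
def ker (hδ : IsSymmBiderivation δ) : LieSubalgebra ℂ L where
  __ := LinearMap.ker δ
  lie_mem' {x y} hx hy := by
    change δ x = 0 at hx
    change δ y = 0 at hy
    change δ ⁅x, y⁆ = 0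
    ext z
    rw [hδ.apply_lie_left hx, hy, LinearMap.zero_apply, lie_zero]

theorem mem_ker (hδ : IsSymmBiderivation δ) {x : L} : x ∈ hδ.ker ↔ δ x = 0 := Iff.rfl

section Triple

variable {h e f : L}

theorem apply_e_f (hδ : IsSymmBiderivation δ) (t : IsSl2Triple h e f) :
    δ e f = (-(1 / 4) : ℂ) • δ h h := by
  have hc := hδ.cyclic h e f
  rw [← lie_skew f h, t.lie_h_e_smul ℂ, t.lie_lie_smul_f ℂ, t.lie_e_f, hδ.symm _ e] at hc
  simp only [map_smul, LinearMap.smul_apply, neg_neg] at hc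
  linear_combination (norm := module) (1 / 4 : ℂ) • hc

theorem two_smul_apply_h_e (hδ : IsSymmBiderivation δ) (t : IsSl2Triple h e f) :
    (2 : ℂ) • δ h e = ⁅h, δ h e⁆ - ⁅e, δ h h⁆ := by
  rw [← hδ.lie_right, t.lie_h_e_smul ℂ, map_smul]

theorem lie_f_apply_h_e (hδ : IsSymmBiderivation δ) (t : IsSl2Triple h e f) :
    ⁅f, δ h e⁆ = (-(1 / 4) : ℂ) • (⁅h, δ h h⁆ + (2 : ℂ) • δ h h) := by
  have hr := hδ.lie_right e h f
  rw [t.lie_lie_smul_f ℂ, map_neg, map_smul, hδ.symm e h, hδ.apply_e_f t, lie_smul] at hr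
  linear_combination (norm := module) hr

theorem sl2Casimir_apply_h_h (hδ : IsSymmBiderivation δ) (t : IsSl2Triple h e f) :
    sl2Casimir ℂ V h e f (δ h h) = 0 := by
  have hfe : ⁅f, ⁅e, δ h h⁆⁆ = ⁅h, ⁅f, δ h e⁆⁆ := by
    have := congrArg (⁅f, ·⁆) (hδ.two_smul_apply_h_e t)
    simp only [lie_smul, lie_sub] at this
    rw [lie_h_lie_f (R := ℂ) t]
    linear_combination (norm := module) this
  rw [sl2Casimir_apply, hfe, hδ.lie_f_apply_h_e t, lie_smul, lie_add, lie_smul]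
  module

variable [FiniteDimensional ℂ V]

theorem apply_h_e (hδ : IsSymmBiderivation δ) (t : IsSl2Triple h e f) : δ h e = 0 := by
  obtain ⟨e_mem, -, h_mem⟩ := (toLieSubalgebra_le_iff (R := ℂ) t).1 le_rfl
  have he := lie_eq_zero_of_sl2Casimir_eq_zero t (hδ.sl2Casimir_apply_h_h t) e_mem
  have hh := lie_eq_zero_of_sl2Casimir_eq_zero t (hδ.sl2Casimir_apply_h_h t) h_mem
  have weight := hδ.two_smul_apply_h_e t
  rw [he, sub_zero] at weight
  refine eq_zero_of_lie_h_eq_two_smul t weight.symm ?_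
  rw [hδ.lie_f_apply_h_e t, hh, zero_add, lie_smul, lie_smul, he, smul_zero, smul_zero]

theorem apply_h_h (hδ : IsSymmBiderivation δ) (t : IsSl2Triple h e f) : δ h h = 0 := by
  obtain ⟨-, -, h_mem⟩ := (toLieSubalgebra_le_iff (R := ℂ) t).1 le_rfl
  have hh := lie_eq_zero_of_sl2Casimir_eq_zero t (hδ.sl2Casimir_apply_h_h t) h_mem
  have hf := hδ.lie_f_apply_h_e t
  rw [hδ.apply_h_e t, lie_zero, hh] at hf
  linear_combination (norm := module) (2 : ℂ) • hf

theorem apply_e_f_eq_zero (hδ : IsSymmBiderivation δ) (t : IsSl2Triple h e f) : δ e f = 0 := by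
  rw [hδ.apply_e_f t, hδ.apply_h_h t, smul_zero]

theorem apply_e (hδ : IsSymmBiderivation δ) (t : IsSl2Triple h e f) : δ e = 0 := by
  have weight (x : L) : (2 : ℂ) • δ e x = ⁅h, δ e x⁆ - ⁅e, δ h x⁆ := by
    rw [← hδ.lie_left, t.lie_h_e_smul ℂ, map_smul, LinearMap.smul_apply]
  have apply_h_lie_h (x : L) : δ h ⁅h, x⁆ = ⁅h, δ h x⁆ := by
    rw [hδ.lie_right, hδ.apply_h_h t, lie_zero, sub_zero]
  have apply_e_lie_h (x : L) : δ e ⁅h, x⁆ = ⁅h, δ e x⁆ := by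
    rw [hδ.lie_right, hδ.symm e h, hδ.apply_h_e t, lie_zero, sub_zero]
  have apply_e_lie_f (x : L) : δ e ⁅f, x⁆ = ⁅f, δ e x⁆ := by
    rw [hδ.lie_right, hδ.apply_e_f_eq_zero t, lie_zero, sub_zero]
  have lie_e_apply_h (x : L) : ⁅e, δ h x⁆ = 0 := by
    have weight_lie := weight ⁅h, x⁆
    have lie_weight := congrArg (⁅h, ·⁆) (weight x)
    simp only [lie_smul, lie_sub] at lie_weight
    rw [apply_e_lie_h, apply_h_lie_h] at weight_lie
    rw [lie_h_lie_e (R := ℂ) t] at lie_weight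
    linear_combination (norm := module) (1 / 2 : ℂ) • (lie_weight - weight_lie)
  have lie_h_apply_e (x : L) : ⁅h, δ e x⁆ = (2 : ℂ) • δ e x := by
    rw [weight, lie_e_apply_h, sub_zero]
  have lie_f_apply_e (x : L) : ⁅f, δ e x⁆ = 0 := by
    have := lie_h_apply_e ⁅f, x⁆
    rw [apply_e_lie_f, lie_h_lie_f (R := ℂ) t, lie_h_apply_e, lie_smul] at this
    linear_combination (norm := module) (-1 / 2 : ℂ) • this
  ext x
  exact eq_zero_of_lie_h_eq_two_smul t (lie_h_apply_e x) (by rw [lie_f_apply_e, lie_zero])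

theorem toLieSubalgebra_le_ker (hδ : IsSymmBiderivation δ) (t : IsSl2Triple h e f) :
    t.toLieSubalgebra ℂ ≤ hδ.ker := by
  have he : e ∈ hδ.ker := hδ.mem_ker.2 (hδ.apply_e t)
  have hf : f ∈ hδ.ker := hδ.mem_ker.2 (hδ.apply_e t.symm)
  have hh : h ∈ hδ.ker := t.lie_e_f ▸ hδ.ker.lie_mem he hf
  exact (toLieSubalgebra_le_iff t).2 ⟨he, hf, hh⟩

end Triple

end IsSymmBiderivation

section PerfectIdeal

variable {R L : Type*} [CommRing R] [LieRing L] [LieAlgebra R L] {S : Set L}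

/-- Writing `s ∈ S` through brackets of elements of `S` turns `[s, a]` into a combination of
`[s', b]` with `b = [s'', a]`, so the subalgebra generated by all `[s, a]` is already an ideal. -/
theorem IsPerfectSubset.lieSpan_le (hS : IsPerfectSubset R S) {N : LieSubalgebra R L}
    (hN : ∀ s ∈ S, ∀ x : L, ⁅s, x⁆ ∈ N) :
    (LieSubmodule.lieSpan R L S).toSubmodule ≤ N.toSubmodule := by
  let A := LieSubalgebra.lieSpan R L (Set.image2 (⁅·, ·⁆) S Set.univ)
  have hAN : A ≤ N :=
    LieSubalgebra.lieSpan_le.2 (Set.image2_subset_iff.2 fun s hs x _ => hN s hs x)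
  have lie_mem_A {s : L} (hs : s ∈ S) (x : L) : ⁅s, x⁆ ∈ A :=
    LieSubalgebra.subset_lieSpan ⟨s, hs, x, trivial, rfl⟩
  have lie_lie_mem_A {s : L} (hs : s ∈ S) (x : L) {b : L} (hb : b ∈ A) : ⁅x, ⁅s, b⁆⁆ ∈ A := by
    rw [leibniz_lie, ← lie_skew x s]
    exact add_mem (A.lie_mem (neg_mem (lie_mem_A hs x)) hb) (lie_mem_A hs _)
  have lie_generator_mem_A {s : L} (hs : s ∈ S) (x y : L) : ⁅x, ⁅s, y⁆⁆ ∈ A := by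
    refine hS.lie_mem (N := A.toSubmodule.comap (LieAlgebra.ad R L x)) (fun s₁ h₁ s₂ h₂ => ?_) hs
    rw [lie_lie]
    exact sub_mem (lie_lie_mem_A h₁ x (lie_mem_A h₂ y)) (lie_lie_mem_A h₂ x (lie_mem_A h₁ y))
  have isIdeal {x y : L} (hy : y ∈ A) : ⁅x, y⁆ ∈ A := by
    induction hy using LieSubalgebra.lieSpan_induction with
    | mem _ h => obtain ⟨s, hs, y, -, rfl⟩ := h; exact lie_generator_mem_A hs x y
    | zero => rw [lie_zero]; exact zero_mem A
    | add _ _ _ _ hy hz => rw [lie_add]; exact add_mem hy hz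
    | smul c _ _ hy => rw [lie_smul]; exact A.smul_mem c hy
    | lie y z hy_mem hz_mem hy hz =>
      rw [leibniz_lie]
      exact add_mem (A.lie_mem hy hz_mem) (A.lie_mem hy_mem hz)
  let I : LieIdeal R L := { A.toSubmodule with lie_mem := isIdeal }
  have hSI : S ⊆ I := fun s hs => by
    have : Submodule.span R (Set.image2 (⁅·, ·⁆) S S) ≤ A.toSubmodule :=
      Submodule.span_le.2 (Set.image2_subset_iff.2 fun _ h₁ x _ => lie_mem_A h₁ x)
    exact this (hS hs)
  exact fun x hx => hAN (LieSubmodule.lieSpan_le.2 hSI hx)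

variable (R L) in
/-- The union of the copies of `sl₂` in `L`. -/
def sl2Set : Set L :=
  ⋃ (h : L) (e : L) (f : L) (t : IsSl2Triple h e f), (t.toLieSubalgebra R : Set L)

variable (R L) in
/-- The ideal of `L` generated by all its `sl₂`-triples. For a finite-dimensional complex Lie
algebra it is the ideal generated by a Levi subalgebra. -/
def sl2Ideal : LieIdeal R L :=
  LieSubmodule.lieSpan R L (sl2Set R L)

theorem mem_sl2Set {x : L} : x ∈ sl2Set R L ↔
    ∃ (h e f : L) (t : IsSl2Triple h e f), x ∈ t.toLieSubalgebra R := by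
  simp only [sl2Set, Set.mem_iUnion, SetLike.mem_coe]

theorem toLieSubalgebra_le_sl2Ideal {h e f : L} (t : IsSl2Triple h e f) :
    (t.toLieSubalgebra R).toSubmodule ≤ (sl2Ideal R L).toSubmodule :=
  fun _ hx => LieSubmodule.subset_lieSpan (mem_sl2Set.2 ⟨h, e, f, t, hx⟩)

variable (R) in
theorem mem_sl2Ideal {h e f : L} (t : IsSl2Triple h e f) :
    e ∈ sl2Ideal R L ∧ f ∈ sl2Ideal R L ∧ h ∈ sl2Ideal R L :=
  (toLieSubalgebra_le_iff t).1 (toLieSubalgebra_le_sl2Ideal t)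

theorem isPerfectSubset_sl2Set {K : Type*} [Field K] [NeZero (2 : K)] [LieAlgebra K L] :
    IsPerfectSubset K (sl2Set K L) :=
  .iUnion fun _ => .iUnion fun _ => .iUnion fun _ => .iUnion isPerfectSubset_toLieSubalgebra

end PerfectIdeal

namespace IsSymmBiderivation

variable {L V : Type*} [LieRing L] [LieAlgebra ℂ L] [AddCommGroup V] [Module ℂ V]
  [LieRingModule L V] [LieModule ℂ L V] {δ : L →ₗ[ℂ] L →ₗ[ℂ] V}

theorem lieSpan_le_ker (hδ : IsSymmBiderivation δ) {S : Set L} (hS : IsPerfectSubset ℂ S)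
    (hSδ : S ⊆ hδ.ker) : (LieSubmodule.lieSpan ℂ L S).toSubmodule ≤ hδ.ker.toSubmodule := by
  refine hS.lieSpan_le fun s hs x => ?_
  ext y
  rw [hδ.apply_lie_left (hδ.mem_ker.1 (hSδ hs)), LinearMap.zero_apply, ← Submodule.mem_bot ℂ]
  exact hS.lie_mem (fun s₁ h₁ s₂ h₂ => hδ.lie_lie_apply (hSδ h₁) (hSδ h₂) x y) hs

theorem sl2Ideal_le_ker [FiniteDimensional ℂ V] (hδ : IsSymmBiderivation δ) :
    (sl2Ideal ℂ L).toSubmodule ≤ hδ.ker.toSubmodule := by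
  refine hδ.lieSpan_le_ker isPerfectSubset_sl2Set fun x hx => ?_
  obtain ⟨h, e, f, t, hx⟩ := mem_sl2Set.1 hx
  exact hδ.toLieSubalgebra_le_ker t hx

theorem eq_zero_of_sl2Ideal_eq_top [FiniteDimensional ℂ V] (hδ : IsSymmBiderivation δ)
    (hL : sl2Ideal ℂ L = ⊤) : δ = 0 :=
  LinearMap.ext fun x => hδ.mem_ker.1 (hδ.sl2Ideal_le_ker (hL ▸ LieSubmodule.mem_top x))

end IsSymmBiderivation

section Constructions

variable {R L L' : Type*} [CommRing R] [LieRing L] [LieAlgebra R L] [LieRing L'] [LieAlgebra R L']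

theorem map_mem_sl2Ideal {φ : L →ₗ⁅R⁆ L'} (hφ : Function.Injective φ) {x : L}
    (hx : x ∈ sl2Ideal R L) : φ x ∈ sl2Ideal R L' := by
  suffices sl2Ideal R L ≤ (sl2Ideal R L').comap φ from LieIdeal.mem_comap.1 (this hx)
  refine LieSubmodule.lieSpan_le.2 fun y hy => LieIdeal.mem_comap.2 ?_
  obtain ⟨h, e, f, t, hy⟩ := mem_sl2Set.1 hy
  obtain ⟨a, b, c, rfl⟩ := t.mem_toLieSubalgebra_iff.1 hy
  have t' : IsSl2Triple (φ h) (φ e) (φ f) :=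
    { h_ne_zero := (map_ne_zero_iff φ hφ).2 t.h_ne_zero
      lie_e_f := by rw [← φ.map_lie, t.lie_e_f]
      lie_h_e_nsmul := by rw [← φ.map_lie, t.lie_h_e_nsmul, map_nsmul]
      lie_h_f_nsmul := by rw [← φ.map_lie, t.lie_h_f_nsmul, map_neg, map_nsmul] }
  exact toLieSubalgebra_le_sl2Ideal t' (t'.mem_toLieSubalgebra_iff.2 ⟨a, b, c, by simp⟩)

theorem sl2Ideal_prod (hL : sl2Ideal R L = ⊤) (hL' : sl2Ideal R L' = ⊤) :
    sl2Ideal R (L × L') = ⊤ := by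
  refine eq_top_iff.2 fun ⟨x, y⟩ _ => ?_
  have hx := map_mem_sl2Ideal (LieHom.inl_injective (R := R) (L₁ := L) (L₂ := L'))
    (hL ▸ LieSubmodule.mem_top x)
  have hy := map_mem_sl2Ideal (LieHom.inr_injective (R := R) (L₁ := L) (L₂ := L'))
    (hL' ▸ LieSubmodule.mem_top y)
  simpa using add_mem hx hy

open LieAlgebra LieAlgebra.SemiDirectSum in
theorem sl2Ideal_semiDirectSum {ψ : L' →ₗ⁅R⁆ LieDerivation R L L} (hL' : sl2Ideal R L' = ⊤)
    (hψ : LieSubalgebra.lieSpan R L (Set.range fun p : L' × L => ψ p.1 p.2) = ⊤) :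
    sl2Ideal R (L ⋊⁅ψ⁆ L') = ⊤ := by
  have inr_mem (x : L') : inr ψ x ∈ sl2Ideal R (L ⋊⁅ψ⁆ L') :=
    map_mem_sl2Ideal (fun _ _ h => congrArg SemiDirectSum.right h) (hL' ▸ LieSubmodule.mem_top x)
  have range_le : LieSubalgebra.lieSpan R L (Set.range fun p : L' × L => ψ p.1 p.2) ≤
      ((sl2Ideal R (L ⋊⁅ψ⁆ L')).toLieSubalgebra).comap (inl ψ) := by
    rw [LieSubalgebra.lieSpan_le]
    rintro _ ⟨⟨x, v⟩, rfl⟩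
    have lie_mem : ⁅inr ψ x, inl ψ v⁆ ∈ sl2Ideal R (L ⋊⁅ψ⁆ L') :=
      lie_mem_left R _ _ _ _ (inr_mem x)
    simpa using lie_mem
  refine eq_top_iff.2 fun ⟨v, x⟩ _ => ?_
  have hv : inl ψ v ∈ sl2Ideal R (L ⋊⁅ψ⁆ L') := range_le (hψ ▸ LieSubalgebra.mem_top v)
  simpa using add_mem hv (inr_mem x)

end Constructions

section SpecialLinear

open LieAlgebra.SpecialLinear

variable {n R : Type*} [Fintype n] [DecidableEq n] [CommRing R] [Nontrivial R]

theorem isSl2Triple_single {i j : n} (hij : i ≠ j) :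
    IsSl2Triple (singleSubSingle i j (1 : R)) (single i j hij 1) (single j i hij.symm 1) where
  h_ne_zero h0 := by
    have := congrFun₂ (congrArg Subtype.val h0) i i
    simp [hij.symm] at this
  lie_e_f := by ext1; simp [Ring.lie_def]
  lie_h_e_nsmul := by ext1; simp [Ring.lie_def, sub_mul, mul_sub, hij.symm, two_smul]
  lie_h_f_nsmul := by
    ext1
    simp [Ring.lie_def, sub_mul, mul_sub, hij, two_smul, ← sub_eq_add_neg]

theorem sl2Ideal_sl : sl2Ideal R (sl n R) = ⊤ := by
  have single_mem {i j : n} (hij : i ≠ j) (r : R) : single i j hij r ∈ sl2Ideal R (sl n R) := by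
    simpa [← map_smul] using
      Submodule.smul_mem _ r (mem_sl2Ideal R (isSl2Triple_single (R := R) hij)).1
  have singleSubSingle_mem (i j : n) (r : R) : singleSubSingle i j r ∈ sl2Ideal R (sl n R) := by
    obtain rfl | hij := eq_or_ne i j
    · have : singleSubSingle i i r = 0 := by ext1; simp
      exact this ▸ zero_mem _
    · simpa [← map_smul] using
        Submodule.smul_mem _ r (mem_sl2Ideal R (isSl2Triple_single (R := R) hij)).2.2
  refine eq_top_iff.2 fun A _ => ?_
  obtain _ | ⟨⟨k⟩⟩ := isEmpty_or_nonempty n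
  · exact Subsingleton.elim 0 A ▸ zero_mem _
  let T (i j : n) : sl n R :=
    if hij : i = j then singleSubSingle i k (A.val i j) else single i j hij (A.val i j)
  have val_T (i j : n) : (T i j).val =
      Matrix.single i j (A.val i j) - if i = j then Matrix.single k k (A.val i j) else 0 := by
    by_cases hij : i = j <;> simp [T, hij]
  have hA : A = ∑ i, ∑ j, T i j := by
    have trace_eq_zero : ∑ i, A.val i i = 0 := A.property
    have sum_single : ∑ i, Matrix.single k k (A.val i i) = 0 := by
      simp only [← Matrix.singleLinearMap_apply (R := R), ← map_sum, trace_eq_zero, map_zero]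
    ext1
    simp only [AddSubmonoidClass.coe_finsetSum, val_T, Finset.sum_sub_distrib,
      ← Matrix.matrix_eq_sum_single, Finset.sum_ite_eq, Finset.mem_univ, if_true, sum_single,
      sub_zero]
  rw [hA]
  refine sum_mem fun i _ => sum_mem fun j _ => ?_
  by_cases hij : i = j
  · simpa only [T, dif_pos hij] using singleSubSingle_mem i k _
  · simpa only [T, dif_neg hij] using single_mem hij _

end SpecialLinear

section Orthogonal

open LieAlgebra.Orthogonal

theorem isSl2Triple_of_lie_cyclic {K L : Type*} [Field K] [NeZero (2 : K)] [LieRing L]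
    [LieAlgebra K L] {x y z : L} {b : K} (hb : -1 = b * b) (hx : x ≠ 0) (hxy : ⁅x, y⁆ = z)
    (hyz : ⁅y, z⁆ = x) (hzx : ⁅z, x⁆ = y) :
    IsSl2Triple ((2 * b) • x) (y + b • z) (b • z - y) := by
  have b_ne_zero : b ≠ 0 := by rintro rfl; simp at hb
  have hzy : ⁅z, y⁆ = -x := by rw [← lie_skew, hyz]
  have hxz : ⁅x, z⁆ = -y := by rw [← lie_skew, hzx]
  refine ⟨smul_ne_zero (mul_ne_zero two_ne_zero b_ne_zero) hx, ?_, ?_, ?_⟩ <;>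
    simp only [lie_add, add_lie, lie_sub, lie_smul, smul_lie, lie_self, hxy, hyz, hzy, hxz]
  · module
  · linear_combination (norm := module) (2 : K) • congrArg (· • y) hb
  · linear_combination (norm := module) (2 : K) • congrArg (· • y) hb

variable {n : Type*} [Fintype n] [DecidableEq n]

/-- Twice the projection of the `n × n` matrices onto the skew-symmetric ones. -/
def skewPart (n R : Type*) [Fintype n] [DecidableEq n] [CommRing R] :
    Matrix n n R →ₗ[R] so n R where
  toFun A := ⟨A - A.transpose, by rw [mem_so]; simp⟩
  map_add' A B := by ext1; simp [add_sub_add_comm]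
  map_smul' c A := by ext1; simp [smul_sub]

section CommRing

variable {R : Type*} [CommRing R]

theorem coe_skewPart (A : Matrix n n R) : (skewPart n R A).val = A - A.transpose := rfl

theorem skewPart_coe (A : so n R) : skewPart n R A.val = (2 : R) • A := by
  ext1
  rw [coe_skewPart, (mem_so n R A.val).1 A.property, SetLike.val_smul]
  module

theorem skewPart_transpose (A : Matrix n n R) : skewPart n R A.transpose = -skewPart n R A := by
  ext1
  simp [coe_skewPart]

theorem lie_skewPart_single {i j k : n} (hij : i ≠ j) (hjk : j ≠ k) (hik : i ≠ k) :
    ⁅skewPart n R (.single i j 1), skewPart n R (.single j k 1)⁆ =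
      skewPart n R (.single i k 1) := by
  ext1
  simp [coe_skewPart, Ring.lie_def, mul_sub, sub_mul, hij, hik, hjk, hij.symm, hik.symm, hjk.symm]

end CommRing

variable {K : Type*} [Field K] [NeZero (2 : K)]

theorem skewPart_single_mem_sl2Ideal (hK : IsSquare (-1 : K)) {i j k : n} (hij : i ≠ j)
    (hjk : j ≠ k) (hik : i ≠ k) : skewPart n K (.single i j 1) ∈ sl2Ideal K (so n K) := by
  obtain ⟨b, hb⟩ := hK
  have b_ne_zero : b ≠ 0 := by rintro rfl; simp at hb
  have skewPart_swap (a c : n) :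
      skewPart n K (.single a c 1) = -skewPart n K (.single c a 1) := by
    rw [← skewPart_transpose, Matrix.transpose_single]
  have ne_zero : skewPart n K (.single i j 1) ≠ 0 := fun h0 => by
    have := congrFun₂ (congrArg Subtype.val h0) i j
    simp [coe_skewPart, hij.symm] at this
  have t := isSl2Triple_of_lie_cyclic hb ne_zero (lie_skewPart_single hij hjk hik)
    (by rw [skewPart_swap i k, lie_neg, lie_skewPart_single hjk hik.symm hij.symm,
      ← skewPart_swap])
    (by rw [skewPart_swap i k, neg_lie, lie_skewPart_single hik.symm hij hjk.symm,
      ← skewPart_swap])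
  exact (Submodule.smul_mem_iff _ (mul_ne_zero two_ne_zero b_ne_zero)).1 (mem_sl2Ideal K t).2.2

theorem sl2Ideal_so (hK : IsSquare (-1 : K)) (hn : Fintype.card n ≠ 2) :
    sl2Ideal K (so n K) = ⊤ := by
  have single_mem (i j : n) : skewPart n K (.single i j 1) ∈ sl2Ideal K (so n K) := by
    obtain rfl | hij := eq_or_ne i j
    · have : skewPart n K (.single i i 1) = 0 := by ext1; simp [coe_skewPart]
      exact this ▸ zero_mem _
    obtain ⟨k, hk⟩ : ∃ k, k ∉ ({i, j} : Finset n) := by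
      by_contra! hc
      rw [← Finset.eq_univ_iff_forall] at hc
      exact hn (by rw [← Finset.card_univ, ← hc, Finset.card_pair hij])
    simp only [Finset.mem_insert, Finset.mem_singleton, not_or] at hk
    exact skewPart_single_mem_sl2Ideal hK hij (Ne.symm hk.2) (Ne.symm hk.1)
  refine eq_top_iff.2 fun A _ => ?_
  rw [← LieSubmodule.mem_toSubmodule, ← Submodule.smul_mem_iff _ (two_ne_zero (α := K)),
    ← skewPart_coe, Matrix.matrix_eq_sum_single A.val]
  simp only [map_sum]
  refine sum_mem fun i _ => sum_mem fun j _ => ?_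
  simpa [← map_smul] using Submodule.smul_mem _ (A.val i j) (single_mem i j)

end Orthogonal

section Symplectic

open LieAlgebra.Symplectic Matrix

variable {l : Type*} [Fintype l] [DecidableEq l]

section CommRing

variable {R : Type*} [CommRing R]

theorem fromBlocks_mem_sp {A B C D : Matrix l l R} :
    fromBlocks A B C D ∈ sp l R ↔ D = -Aᵀ ∧ B.IsSymm ∧ C.IsSymm := by
  rw [sp, mem_skewAdjointMatricesLieSubalgebra, mem_skewAdjointMatricesSubmodule]
  change _ * _ = _ * _ ↔ _
  simp only [J, fromBlocks_transpose, fromBlocks_multiply, fromBlocks_neg, fromBlocks_inj]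
  simp only [mul_zero, mul_one, mul_neg, zero_add, add_zero, zero_mul, one_mul, neg_mul, neg_neg,
    neg_zero, neg_inj]
  constructor
  · rintro ⟨hC, hD, -, hB⟩
    exact ⟨hD.symm, hB, hC⟩
  · rintro ⟨rfl, hB, hC⟩
    exact ⟨hC, rfl, by simp, hB⟩

variable (l R) in
/-- The element of `sp` with diagonal blocks `A` and `-Aᵀ` and zero off-diagonal blocks. -/
def spDiag : Matrix l l R →ₗ[R] sp l R where
  toFun A := ⟨fromBlocks A 0 0 (-Aᵀ), fromBlocks_mem_sp.2 (by simp)⟩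
  map_add' A B := by ext1; simp [fromBlocks_add, add_comm]
  map_smul' c A := by ext1; simp [fromBlocks_smul]

/-- The element of `sp` with zero diagonal blocks and off-diagonal blocks `B` and `C`. -/
def spOff (B C : Matrix l l R) (hB : B.IsSymm) (hC : C.IsSymm) : sp l R :=
  ⟨fromBlocks 0 B C 0, fromBlocks_mem_sp.2 ⟨by simp, hB, hC⟩⟩

theorem coe_spDiag (A : Matrix l l R) : (spDiag l R A).val = fromBlocks A 0 0 (-Aᵀ) := rfl

theorem coe_spOff {B C : Matrix l l R} (hB : B.IsSymm) (hC : C.IsSymm) :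
    (spOff B C hB hC).val = fromBlocks 0 B C 0 := rfl

theorem exists_eq_spDiag_add_spOff (M : sp l R) :
    ∃ A B C hB hC, M = spDiag l R A + spOff B C hB hC := by
  obtain ⟨A, B, C, D, h⟩ : ∃ A B C D, M.val = fromBlocks A B C D :=
    ⟨_, _, _, _, (fromBlocks_toBlocks M.val).symm⟩
  obtain ⟨hD, hB, hC⟩ := fromBlocks_mem_sp.1 (h ▸ M.property)
  exact ⟨A, B, C, hB, hC, by ext1; simp [coe_spDiag, coe_spOff, fromBlocks_add, h, hD]⟩

theorem lie_spDiag_one_spOff {B C : Matrix l l R} (hB : B.IsSymm) (hC : C.IsSymm) :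
    ⁅spDiag l R 1, spOff B C hB hC⁆ = (2 : R) • spOff B (-C) hB hC.neg := by
  ext1
  simp [coe_spDiag, coe_spOff, Ring.lie_def, fromBlocks_multiply, sub_eq_add_neg, fromBlocks_neg,
    fromBlocks_add, two_smul]

theorem lie_spOff_spOff {B C : Matrix l l R} (hB : B.IsSymm) (hC : C.IsSymm) :
    ⁅spOff B 0 hB isSymm_zero, spOff 0 C isSymm_zero hC⁆ = spDiag l R (B * C) := by
  ext1
  simp [coe_spDiag, coe_spOff, Ring.lie_def, fromBlocks_multiply, sub_eq_add_neg, fromBlocks_neg,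
    fromBlocks_add, hB.eq, hC.eq]

theorem isSl2Triple_spDiag_one [Nontrivial R] [Nonempty l] :
    IsSl2Triple (spDiag l R 1) (spOff 1 0 isSymm_one isSymm_zero)
      (spOff 0 1 isSymm_zero isSymm_one) where
  h_ne_zero h0 := by
    obtain ⟨i⟩ := ‹Nonempty l›
    have := congrFun₂ (congrArg Subtype.val h0) (Sum.inl i) (Sum.inl i)
    simp [coe_spDiag] at this
  lie_e_f := by rw [lie_spOff_spOff, mul_one]
  lie_h_e_nsmul := by
    rw [lie_spDiag_one_spOff, ofNat_smul_eq_nsmul]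
    simp only [neg_zero]
  lie_h_f_nsmul := by
    rw [lie_spDiag_one_spOff, ofNat_smul_eq_nsmul, ← smul_neg]
    congr 1
    ext1
    simp [coe_spOff, fromBlocks_neg]

end CommRing

variable {K : Type*} [Field K] [NeZero (2 : K)]

theorem sl2Ideal_sp : sl2Ideal K (sp l K) = ⊤ := by
  refine eq_top_iff.2 fun M _ => ?_
  obtain _ | _ := isEmpty_or_nonempty l
  · exact Subsingleton.elim 0 M ▸ zero_mem _
  have spOff_mem {B C : Matrix l l K} (hB : B.IsSymm) (hC : C.IsSymm) :
      spOff B C hB hC ∈ sl2Ideal K (sp l K) := by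
    have := lie_mem_left K _ _ _ (spOff B (-C) hB hC.neg)
      (mem_sl2Ideal K (isSl2Triple_spDiag_one (l := l) (R := K))).2.2
    rw [lie_spDiag_one_spOff] at this
    simpa only [neg_neg, LieSubmodule.mem_toSubmodule] using
      (Submodule.smul_mem_iff _ (two_ne_zero (α := K))).1 this
  have spDiag_single_mem (i j : l) : spDiag l K (single i j 1) ∈ sl2Ideal K (sp l K) := by
    have hB : (single i i (1 : K)).IsSymm := transpose_single i i 1
    have hC : (single i j (1 : K) + single j i 1).IsSymm := by
      simp [Matrix.IsSymm, add_comm]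
    have := lie_mem_left K _ _ _ (spOff 0 _ isSymm_zero hC)
      (spOff_mem hB isSymm_zero)
    rw [lie_spOff_spOff] at this
    obtain rfl | hij := eq_or_ne i j
    · rw [← two_smul K, mul_smul_comm, single_mul_single_same, mul_one, map_smul] at this
      exact (Submodule.smul_mem_iff _ (two_ne_zero (α := K))).1 this
    · simpa [mul_add, hij] using this
  obtain ⟨A, B, C, hB, hC, rfl⟩ := exists_eq_spDiag_add_spOff M
  refine add_mem ?_ (spOff_mem hB hC)
  rw [matrix_eq_sum_single A]
  simp only [map_sum]
  refine sum_mem fun i _ => sum_mem fun j _ => ?_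
  simpa [← map_smul] using Submodule.smul_mem _ (A i j) (spDiag_single_mem i j)

end Symplectic

namespace HeisenbergAlgebra

variable {n : ℕ}

theorem exists_omega_eq_one (hn : 1 ≤ n) : ∃ v w : Fin n ⊕ Fin n → ℂ, omega v w = 1 :=
  ⟨Pi.single (Sum.inl ⟨0, hn⟩) 1, Pi.single (Sum.inr ⟨0, hn⟩) 1, by
    simp [omega, Pi.single_apply]⟩

theorem lieSpan_range_spAction (hn : 1 ≤ n) {L : Type*} [LieRing L] [LieAlgebra ℂ L]
    (ρ : L →ₗ⁅ℂ⁆ LieAlgebra.Symplectic.sp (Fin n) ℂ) {x : L}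
    (hx : ρ x = spDiag (Fin n) ℂ 1) :
    LieSubalgebra.lieSpan ℂ (HeisenbergAlgebra n)
      (Set.range fun p : L × HeisenbergAlgebra n => (spAction n).comp ρ p.1 p.2) = ⊤ := by
  set N := LieSubalgebra.lieSpan ℂ (HeisenbergAlgebra n)
    (Set.range fun p : L × HeisenbergAlgebra n => (spAction n).comp ρ p.1 p.2)
  have involutive (v : Fin n ⊕ Fin n → ℂ) :
      (spDiag (Fin n) ℂ 1).val.mulVec ((spDiag (Fin n) ℂ 1).val.mulVec v) = v := by
    simp [Matrix.mulVec_mulVec, coe_spDiag, Matrix.fromBlocks_multiply]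
  have vec_mem (v : Fin n ⊕ Fin n → ℂ) : (⟨v, 0⟩ : HeisenbergAlgebra n) ∈ N := by
    refine LieSubalgebra.subset_lieSpan ⟨(x, ⟨(spDiag (Fin n) ℂ 1).val.mulVec v, 0⟩), ?_⟩
    ext1
    · change (ρ x).val.mulVec _ = v
      rw [hx, involutive]
    · rfl
  obtain ⟨v, w, hvw⟩ := exists_omega_eq_one hn
  refine eq_top_iff.2 fun y _ => ?_
  have hy : y = ⟨y.vec, 0⟩ + y.coeff • ⁅(⟨v, 0⟩ : HeisenbergAlgebra n), ⟨w, 0⟩⁆ := by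
    ext1 <;> simp [hvw]
  rw [hy]
  exact add_mem (vec_mem _) (N.smul_mem _ (N.lie_mem (vec_mem v) (vec_mem w)))

instance : Module.Finite ℂ (HeisenbergAlgebra n) :=
  Module.Finite.equiv (toProd.linearEquiv ℂ).symm

end HeisenbergAlgebra

instance {R L L' : Type*} [CommRing R] [LieRing L] [LieAlgebra R L] [LieRing L'] [LieAlgebra R L']
    [Module.Finite R L] [Module.Finite R L'] (ψ : L' →ₗ⁅R⁆ LieDerivation R L L) :
    Module.Finite R (LieAlgebra.SemiDirectSum L L' ψ) :=
  Module.Finite.equiv (LieAlgebra.SemiDirectSum.toProdl ψ).symm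

section Schrodinger

open HeisenbergAlgebra

variable {n : ℕ}

theorem sl2Ideal_schrodingerSp (hn : 1 ≤ n) : sl2Ideal ℂ (SchrodingerSp n) = ⊤ :=
  sl2Ideal_semiDirectSum (sl2Ideal_prod sl2Ideal_sl sl2Ideal_sp)
    (lieSpan_range_spAction hn _ (x := (0, spDiag (Fin n) ℂ 1)) rfl)

theorem slSoToSp_singleSubSingle :
    slSoToSp n (LieAlgebra.SpecialLinear.singleSubSingle 0 1 1, 0) = spDiag (Fin n) ℂ 1 := by
  ext1
  simp [slSoToSp, coe_spDiag]

theorem sl2Ideal_schrodingerSO (hn : 1 ≤ n) (hn2 : n ≠ 2) : sl2Ideal ℂ (SchrodingerSO n) = ⊤ :=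
  sl2Ideal_semiDirectSum
    (sl2Ideal_prod sl2Ideal_sl
      (sl2Ideal_so (IsAlgClosed.exists_eq_mul_self _) (by rwa [Fintype.card_fin])))
    (lieSpan_range_spAction hn _ slSoToSp_singleSubSingle)

end Schrodinger

theorem mainTheorem11_general (n : ℕ) (hn : 1 ≤ n) :
    (∀ (V : Type*) [AddCommGroup V] [Module ℂ V] [FiniteDimensional ℂ V]
      [LieRingModule (SchrodingerSp n) V] [LieModule ℂ (SchrodingerSp n) V]
      (δ : SchrodingerSp n →ₗ[ℂ] SchrodingerSp n →ₗ[ℂ] V), IsSymmBiderivation δ → δ = 0) ∧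
    (n ≠ 2 → ∀ (V : Type*) [AddCommGroup V] [Module ℂ V] [FiniteDimensional ℂ V]
      [LieRingModule (SchrodingerSO n) V] [LieModule ℂ (SchrodingerSO n) V]
      (δ : SchrodingerSO n →ₗ[ℂ] SchrodingerSO n →ₗ[ℂ] V), IsSymmBiderivation δ → δ = 0) :=
  ⟨fun _ _ _ _ _ _ _ hδ => hδ.eq_zero_of_sl2Ideal_eq_top (sl2Ideal_schrodingerSp hn),
    fun hn2 _ _ _ _ _ _ _ hδ => hδ.eq_zero_of_sl2Ideal_eq_top (sl2Ideal_schrodingerSO hn hn2)⟩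

theorem mainTheorem11 (n : ℕ) (hn : 1 ≤ n) :
    (∀ δ : SchrodingerSp n →ₗ[ℂ] SchrodingerSp n →ₗ[ℂ] SchrodingerSp n,
      IsSymmBiderivation δ → δ = 0) ∧
    (n ≠ 2 → ∀ δ : SchrodingerSO n →ₗ[ℂ] SchrodingerSO n →ₗ[ℂ] SchrodingerSO n,
      IsSymmBiderivation δ → δ = 0) :=
  ⟨(mainTheorem11_general.{0, 0} n hn).1 _, fun hn2 => (mainTheorem11_general.{0, 0} n hn).2 hn2 _⟩
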